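/- Let $d\ge 2$. Let $\mathcal I=\{(i^1,\dots,i^d): 1\le i^1\le m,\ 1\le i^2\le m_{i^1},\ \dots,\ 1\le i^d\le m_{i^1\cdots i^{d-1}}\}$, where all the numbers $m, m_{i^1},\dots,m_{i^1\cdots i^{d-1}}$ are positive integers. For every prefix $(i^1,\dots,i^k)$, $1\le k\le d$, of an element of $\mathcal I$ let $0<a_{i^1\cdots i^k}<1$ and $0\le u_{i^1\cdots i^k}<1$ be real numbers such that, for $k=1,\dots,d$ and all admissible indices (with $m_{i^1\cdots i^{k-1}}$ read as $m$ when $k=1$): (i) $a_{i^1\cdots i^{k}}\le a_{i^1\cdots i^{k-1}}$ if $k\ge 2$; (ii) $\sum_{i^k} a_{i^1\cdots i^k}\le 1$; (iii) $u_{i^1\cdots i^{k-1}i}<u_{i^1\cdots i^{k-1}(i+1)}$ and $u_{i^1\cdots i^{k-1}(i+1)}-u_{i^1\cdots i^{k-1}i}\ge a_{i^1\cdots i^{k-1}i}$ for $1\le i<m_{i^1\cdots i^{k-1}}$, and $1-u_{i^1\cdots i^{k-1}i}\ge a_{i^1\cdots i^{k-1}i}$ for $i=m_{i^1\cdots i^{k-1}}$.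 For $(i^1,\dots,i^d)\in\mathcal I$ let $$A_{i^1\cdots i^d}(x_1,\dots,x_d)=\bigl(a_{i^1\cdots i^d}x_1+u_{i^1\cdots i^d},\ a_{i^1\cdots i^{d-1}}x_2+u_{i^1\cdots i^{d-1}},\ \dots,\ a_{i^1}x_d+u_{i^1}\bigr),$$ and let $\Lambda\subset\mathbb R^d$ be the corresponding self-affine sponge, i.e. the unique nonempty compact set with $\Lambda=\bigcup_{(i^1,\dots,i^d)\in\mathcal I}A_{i^1\cdots i^d}(\Lambda)$. For a probability vector $\mathbf p=(p_{i^1\cdots i^{d-1}})$ on the set of prefixes of length $d-1$, with marginals $p_{i^1\cdots i^k}=\sum_{i^{k+1}}p_{i^1\cdots i^{k+1}}$, put, for $k=1,\dots,d-1$, $$\lambda_k(\mathbf p)=\frac{\sum_{i^1\cdots i^k}p_{i^1\cdots i^k}\log p_{i^1\cdots i^k}-\sum_{i^1\cdots i^{k-1}}p_{i^1\cdots i^{k-1}}\log p_{i^1\cdots i^{k-1}}}{\sum_{i^1\cdots i^k}p_{i^1\cdots i^k}\log a_{i^1\cdots i^k}}$$ (with $0\log 0=0$, the second sum in the numerator being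 $0$ for $k=1$), and let $t(\mathbf p)$ be the unique $t\in[0,1]$ with $$\sum_{i^1\cdots i^{d-1}}p_{i^1\cdots i^{d-1}}\log\Bigl(\sum_{i^d}a_{i^1\cdots i^d}^{\,t}\Bigr)=0 .$$ Then $$\dim_H\Lambda\ \ge\ \sup_{\mathbf p}\Bigl\{\sum_{k=1}^{d-1}\lambda_k(\mathbf p)+t(\mathbf p)\Bigr\},$$ where the supremum is over all such probability vectors $\mathbf p$. -/

import Mathlib

open Finset

/-- Words of length `k` in the tree with branching numbers `m`: the word `[i¹, …, iᵏ]` is kept iff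
each letter `iʲ⁺¹` is one of the `m [i¹, …, iʲ]` numbers `0, …, m [i¹, …, iʲ] - 1`. -/
def treeWords (m : List ℕ → ℕ) : ℕ → Finset (List ℕ)
  | 0 => {[]}
  | k + 1 => (treeWords m k).biUnion fun w => (range (m w)).image fun i => w ++ [i]

theorem mem_treeWords_succ {m : List ℕ → ℕ} {k : ℕ} {v : List ℕ} :
    v ∈ treeWords m (k + 1) ↔ ∃ w ∈ treeWords m k, ∃ i < m w, w ++ [i] = v := by
  simp [treeWords]

theorem sum_treeWords_succ (m : List ℕ → ℕ) (k : ℕ) (f : List ℕ → ℝ) :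
    ∑ v ∈ treeWords m (k + 1), f v =
      ∑ w ∈ treeWords m k, ∑ i ∈ range (m w), f (w ++ [i]) := by
  rw [treeWords, sum_biUnion]
  · refine sum_congr rfl fun w _ => ?_
    rw [sum_image]
    intro i _ j _ h
    simpa using h
  · intro w _ w' _ hne
    refine Finset.disjoint_left.2 fun v hv hv' => hne ?_
    simp only [mem_image] at hv hv'
    obtain ⟨i, _, rfl⟩ := hv
    obtain ⟨j, _, h⟩ := hv'
    exact (List.append_inj' h rfl).1.symm

/-- The defining data of a self-affine sponge in `ℝᵈ`, `d ≥ 2`. The alphabet is the set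
`treeWords m d` of words `[i¹, …, iᵈ]`; for a word `w = [i¹, …, iᵏ]`, `1 ≤ k ≤ d`, the number
`a w` is the length, and `u w` the left end point, of the edge of the boxes with that prefix in the
coordinate direction `x_{d - k + 1}`. -/
structure SelfAffineSponge (d : ℕ) where
  two_le : 2 ≤ d
  m : List ℕ → ℕ
  a : List ℕ → ℝ
  u : List ℕ → ℝ
  m_pos : ∀ k < d, ∀ w ∈ treeWords m k, 0 < m w
  a_pos : ∀ k < d, ∀ w ∈ treeWords m k, ∀ i < m w, 0 < a (w ++ [i])
  a_lt_one : ∀ k < d, ∀ w ∈ treeWords m k, ∀ i < m w, a (w ++ [i]) < 1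
  a_le : ∀ k < d, 1 ≤ k → ∀ w ∈ treeWords m k, ∀ i < m w, a (w ++ [i]) ≤ a w
  sum_a_le_one : ∀ k < d, ∀ w ∈ treeWords m k, ∑ i ∈ range (m w), a (w ++ [i]) ≤ 1
  u_nonneg : ∀ k < d, ∀ w ∈ treeWords m k, ∀ i < m w, 0 ≤ u (w ++ [i])
  u_lt_one : ∀ k < d, ∀ w ∈ treeWords m k, ∀ i < m w, u (w ++ [i]) < 1
  u_lt_succ : ∀ k < d, ∀ w ∈ treeWords m k, ∀ i, i + 1 < m w →
    u (w ++ [i]) < u (w ++ [i + 1])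
  a_le_gap : ∀ k < d, ∀ w ∈ treeWords m k, ∀ i, i + 1 < m w →
    a (w ++ [i]) ≤ u (w ++ [i + 1]) - u (w ++ [i])
  a_le_last : ∀ k < d, ∀ w ∈ treeWords m k, ∀ i, i + 1 = m w →
    a (w ++ [i]) ≤ 1 - u (w ++ [i])

namespace SelfAffineSponge

variable {d : ℕ} (S : SelfAffineSponge d)

/-- The words of length `k` that are prefixes of elements of the alphabet. -/
def words (k : ℕ) : Finset (List ℕ) := treeWords S.m k

/-- The affine map `A_w` of the letter `w = [i¹, …, iᵈ]`. Coordinates are numbered from `0`, so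
the coordinate `j` is governed by the prefix of `w` of length `d - j`. -/
noncomputable def affineMap (w : List ℕ) (x : EuclideanSpace ℝ (Fin d)) :
    EuclideanSpace ℝ (Fin d) :=
  WithLp.toLp 2 fun j : Fin d =>
    S.a (w.take (d - (j : ℕ))) * x j + S.u (w.take (d - (j : ℕ)))

/-- `Λ` is the limit set of the maps `A_w`, that is, the nonempty compact set that is the
union of its images under these maps. -/
structure IsLimitSet (Λ : Set (EuclideanSpace ℝ (Fin d))) : Prop where
  nonempty : Λ.Nonempty
  isCompact : IsCompact Λ
  eq_iUnion : Λ = ⋃ w ∈ S.words d, S.affineMap w '' Λ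

/-- A probability vector `(p_w)` on the words of length `d - 1`, together with its marginals on
shorter words (for the empty word the marginal is the total mass `1`). -/
structure ProbVector where
  p : List ℕ → ℝ
  nonneg : ∀ k ≤ d - 1, ∀ w ∈ S.words k, 0 ≤ p w
  marginal : ∀ k < d - 1, ∀ w ∈ S.words k, p w = ∑ i ∈ range (S.m w), p (w ++ [i])
  total : p [] = 1

namespace ProbVector

variable {S} (P : S.ProbVector)

/-- The number `λ_k(p)`, for `1 ≤ k ≤ d - 1`. -/
noncomputable def lam (k : ℕ) : ℝ :=
  ((∑ w ∈ S.words k, P.p w * Real.log (P.p w)) -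
      (∑ w ∈ S.words (k - 1), P.p w * Real.log (P.p w))) /
    (∑ w ∈ S.words k, P.p w * Real.log (S.a w))

/-- The function of `t` whose zero is the number `t(p)`. -/
noncomputable def moran (t : ℝ) : ℝ :=
  ∑ w ∈ S.words (d - 1), P.p w * Real.log (∑ i ∈ range (S.m w), S.a (w ++ [i]) ^ t)

theorem sum_p_eq_one : ∀ k ≤ d - 1, ∑ w ∈ S.words k, P.p w = 1 := by
  intro k
  induction k with
  | zero => intro _; simp [words, treeWords, P.total]
  | succ k ih =>
    intro hk
    rw [words, sum_treeWords_succ, ← ih (by omega)]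
    exact sum_congr rfl fun w hw => (P.marginal k (by omega) w hw).symm

theorem sum_rpow_pos {w : List ℕ} (hw : w ∈ S.words (d - 1)) (t : ℝ) :
    0 < ∑ i ∈ range (S.m w), S.a (w ++ [i]) ^ t := by
  have hd := S.two_le
  refine sum_pos (fun i hi => Real.rpow_pos_of_pos
    (S.a_pos (d - 1) (by omega) w hw i (mem_range.1 hi)) t) ?_
  exact nonempty_range_iff.2 (S.m_pos (d - 1) (by omega) w hw).ne'

theorem continuous_moran : Continuous P.moran := by
  have hd := S.two_le
  refine continuous_finsetSum _ fun w hw => continuous_const.mul ?_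
  refine Continuous.log ?_ fun t => (sum_rpow_pos hw t).ne'
  exact continuous_finsetSum _ fun i hi => Real.continuous_const_rpow
    (S.a_pos (d - 1) (by omega) w hw i (mem_range.1 hi)).ne'

theorem strictAnti_moran : StrictAnti P.moran := by
  have hd := S.two_le
  have key : ∀ w ∈ S.words (d - 1), StrictAnti fun t : ℝ =>
      Real.log (∑ i ∈ range (S.m w), S.a (w ++ [i]) ^ t) := by
    intro w hw s t hst
    refine Real.log_lt_log (sum_rpow_pos hw t) (sum_lt_sum_of_nonempty
      (nonempty_range_iff.2 (S.m_pos (d - 1) (by omega) w hw).ne') fun i hi => ?_)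
    exact Real.rpow_lt_rpow_of_exponent_gt
      (S.a_pos (d - 1) (by omega) w hw i (mem_range.1 hi))
      (S.a_lt_one (d - 1) (by omega) w hw i (mem_range.1 hi)) hst
  intro s t hst
  have hne : ∑ w ∈ S.words (d - 1), P.p w ≠ 0 := by
    rw [P.sum_p_eq_one (d - 1) le_rfl]; exact one_ne_zero
  obtain ⟨w, hw, hpw⟩ := exists_ne_zero_of_sum_ne_zero hne
  refine sum_lt_sum (fun v hv => mul_le_mul_of_nonneg_left ((key v hv) hst).le
    (P.nonneg _ le_rfl v hv)) ⟨w, hw, ?_⟩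
  exact mul_lt_mul_of_pos_left ((key w hw) hst)
    (lt_of_le_of_ne (P.nonneg _ le_rfl w hw) hpw.symm)

theorem existsUnique_moran : ∃! t : ℝ, t ∈ Set.Icc (0 : ℝ) 1 ∧ P.moran t = 0 := by
  have hd := S.two_le
  have h0 : 0 ≤ P.moran 0 := by
    refine sum_nonneg fun w hw => mul_nonneg (P.nonneg _ le_rfl w hw) ?_
    refine Real.log_nonneg ?_
    have := S.m_pos (d - 1) (by omega) w hw
    simpa using (Nat.one_le_cast (α := ℝ)).2 this
  have h1 : P.moran 1 ≤ 0 := by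
    refine sum_nonpos fun w hw => mul_nonpos_of_nonneg_of_nonpos (P.nonneg _ le_rfl w hw) ?_
    refine Real.log_nonpos (sum_rpow_pos hw 1).le ?_
    simpa using S.sum_a_le_one (d - 1) (by omega) w hw
  obtain ⟨t, ht, hft⟩ := intermediate_value_Icc' zero_le_one P.continuous_moran.continuousOn
    (show (0 : ℝ) ∈ Set.Icc (P.moran 1) (P.moran 0) from ⟨h1, h0⟩)
  exact ⟨t, ⟨ht, hft⟩, fun s hs => P.strictAnti_moran.injective (hs.2.trans hft.symm)⟩

/-- The number `t(p)`: the unique `t ∈ [0, 1]` with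
`∑_w p_w log (∑_i a_{wi} ^ t) = 0`, the outer sum being over the words of length `d - 1`. -/
noncomputable def t : ℝ := P.existsUnique_moran.choose

theorem t_spec : P.t ∈ Set.Icc (0 : ℝ) 1 ∧ P.moran P.t = 0 :=
  P.existsUnique_moran.choose_spec.1

end ProbVector

end SelfAffineSponge

/-!
For a probability vector `p` on the words of length `d - 1`, spread the mass `p w` over the letters
`w ++ [i]` in proportion to `a (w ++ [i]) ^ t(p)` (`ProbVector.gibbs`), and let `μ` be the Bernoulli
measure with these weights on sequences of letters. By the choice of `t(p)`
(`ProbVector.gibbs_entropy_eq`), the number `∑ λ_k(p) + t(p)` is the sum over the `d` coordinates of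
the conditional entropy divided by the Lyapunov exponent. The theorem follows once the projection of
`μ` to the sponge is shown to satisfy, for every `s` less than this sum and on a set of codes `G` of
positive measure, a bound `μ (G ∩ E) ≤ C (diam E) ^ s`: the mass distribution principle
(`ofReal_le_dimH_of_measure_le`) then gives `s ≤ dim_H Λ`.

For a code `ω` and a size `r`, let `L k` be the first level at which the interval of `ω` in the
coordinate governed by the prefixes of length `k + 1` has length at most `r`. Prescribing, for each
`k`, the first `L k` prefixes of length `k + 1` gives an approximate cube of size `r`. As
`a (w ++ [i]) ≤ a w`, the `L k` decrease with `k`, so the measure of the cube is the product over `k`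
and `j < L k` of the conditional probabilities of the prefixes of length `k + 1` given those of
length `k` (`Weights.bernoulli_cube_le`). If `s k` is less than the ratio of entropy to exponent in
the coordinate `k`, then the function `log (conditional probability) - s k * log a` of a letter has
negative mean, so by the strong law of large numbers its partial sums are eventually nonpositive
almost surely; hence the measure of the approximate cubes is at most a constant times
`r ^ ∑ s k` (`Weights.exists_bernoulli_cube_le`).

A set of diameter at most `r` meets a bounded number of approximate cubes
(`exists_finset_latticePoint_mem`). Indeed, with `α` a lower bound for the numbers `a`, every
half-open interval above contains a point of the lattice `α r ℤ`, and the lattice points so obtained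
determine the cube, as half-open intervals of distinct children of one word are disjoint
(`IsCode.take_eq_of_latticePoint_eq`).
-/

/-! ### Words of the tree -/

theorem length_of_mem_treeWords {m : List ℕ → ℕ} {k : ℕ} {w : List ℕ} (hw : w ∈ treeWords m k) :
    w.length = k := by
  induction k generalizing w with
  | zero => simpa [treeWords] using hw
  | succ k ih =>
    obtain ⟨v, hv, i, -, rfl⟩ := mem_treeWords_succ.1 hw
    simp [ih hv]

theorem take_mem_treeWords {m : List ℕ → ℕ} {n k : ℕ} {w : List ℕ} (hw : w ∈ treeWords m n)
    (hk : k ≤ n) : w.take k ∈ treeWords m k := by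
  induction n generalizing w with
  | zero =>
    obtain rfl : k = 0 := by omega
    simp [treeWords]
  | succ n ih =>
    obtain rfl | hkn := hk.eq_or_lt
    · rwa [List.take_of_length_le (length_of_mem_treeWords hw).le]
    · obtain ⟨v, hv, i, -, rfl⟩ := mem_treeWords_succ.1 hw
      rw [List.take_append_of_le_length (by rw [length_of_mem_treeWords hv]; omega)]
      exact ih hv (by omega)

theorem exists_take_succ_eq {m : List ℕ → ℕ} {n k : ℕ} {w : List ℕ} (hw : w ∈ treeWords m n)
    (hk : k < n) : ∃ i < m (w.take k), w.take (k + 1) = w.take k ++ [i] := by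
  obtain ⟨v, hv, i, hi, h⟩ := mem_treeWords_succ.1 (take_mem_treeWords hw (k := k + 1) hk)
  have hvk : v = w.take k := by
    have := congrArg (List.take k) h
    rw [List.take_take, List.take_append_of_le_length (length_of_mem_treeWords hv).ge,
      List.take_of_length_le (length_of_mem_treeWords hv).le] at this
    simpa using this
  subst hvk
  exact ⟨i, hi, h.symm⟩

/-- If every value of `q` is the sum of its values at the children, then the `q`-average over the
words of length `n` of a function of the prefix of length `k` is an average over the words of
length `k`. -/
theorem sum_treeWords_mul_take {m : List ℕ → ℕ} {q : List ℕ → ℝ} {k n : ℕ} (hkn : k ≤ n)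
    (hq : ∀ l < n, ∀ w ∈ treeWords m l, q w = ∑ i ∈ range (m w), q (w ++ [i]))
    (f : List ℕ → ℝ) :
    ∑ v ∈ treeWords m n, q v * f (v.take k) = ∑ w ∈ treeWords m k, q w * f w := by
  induction n, hkn using Nat.le_induction with
  | base =>
    exact sum_congr rfl fun v hv => by
      rw [List.take_of_length_le (length_of_mem_treeWords hv).le]
  | succ n hkn ih =>
    rw [← ih fun l hl => hq l (by omega), sum_treeWords_succ]
    refine sum_congr rfl fun w hw => ?_
    rw [hq n (by omega) w hw, sum_mul]
    refine sum_congr rfl fun i _ => ?_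
    rw [List.take_append_of_le_length (by rw [length_of_mem_treeWords hw]; omega)]

namespace SelfAffineSponge

variable {d : ℕ} (S : SelfAffineSponge d)

theorem u_add_a_le_u {k : ℕ} (hk : k < d) {w : List ℕ} (hw : w ∈ S.words k) {i j : ℕ}
    (hij : i < j) (hj : j < S.m w) :
    S.u (w ++ [i]) + S.a (w ++ [i]) ≤ S.u (w ++ [j]) := by
  induction j, Nat.succ_le_of_lt hij using Nat.le_induction with
  | base => linarith [S.a_le_gap k hk w hw i hj]
  | succ j hj' ih => exact (ih hj' (by omega)).trans (S.u_lt_succ k hk w hw j hj).le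

theorem u_add_a_le_one {k : ℕ} (hk : k < d) {w : List ℕ} (hw : w ∈ S.words k) {i : ℕ}
    (hi : i < S.m w) : S.u (w ++ [i]) + S.a (w ++ [i]) ≤ 1 := by
  obtain h | h := (Nat.succ_le_of_lt hi).eq_or_lt
  · linarith [S.a_le_last k hk w hw i h]
  · exact (S.u_add_a_le_u hk hw (Nat.lt_succ_self i) h).trans (S.u_lt_one k hk w hw _ h).le

/-- The half-open intervals of two children of the same word are disjoint. -/
theorem child_unique {k : ℕ} (hk : k < d) {w : List ℕ} (hw : w ∈ S.words k) {i j : ℕ}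
    (hi : i < S.m w) (hj : j < S.m w) {y : ℝ}
    (hyi : S.u (w ++ [i]) ≤ y) (hyi' : y < S.u (w ++ [i]) + S.a (w ++ [i]))
    (hyj : S.u (w ++ [j]) ≤ y) (hyj' : y < S.u (w ++ [j]) + S.a (w ++ [j])) : i = j := by
  rcases lt_trichotomy i j with h | h | h
  · linarith [S.u_add_a_le_u hk hw h hj]
  · exact h
  · linarith [S.u_add_a_le_u hk hw h hi]

theorem a_take_pos {v : List ℕ} (hv : v ∈ S.words d) {k : ℕ} (hk : k < d) :
    0 < S.a (v.take (k + 1)) := by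
  obtain ⟨i, hi, h⟩ := exists_take_succ_eq hv hk
  rw [h]
  exact S.a_pos k hk _ (take_mem_treeWords hv hk.le) i hi

theorem a_take_lt_one {v : List ℕ} (hv : v ∈ S.words d) {k : ℕ} (hk : k < d) :
    S.a (v.take (k + 1)) < 1 := by
  obtain ⟨i, hi, h⟩ := exists_take_succ_eq hv hk
  rw [h]
  exact S.a_lt_one k hk _ (take_mem_treeWords hv hk.le) i hi

theorem u_take_nonneg {v : List ℕ} (hv : v ∈ S.words d) {k : ℕ} (hk : k < d) :
    0 ≤ S.u (v.take (k + 1)) := by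
  obtain ⟨i, hi, h⟩ := exists_take_succ_eq hv hk
  rw [h]
  exact S.u_nonneg k hk _ (take_mem_treeWords hv hk.le) i hi

theorem u_add_a_take_le_one {v : List ℕ} (hv : v ∈ S.words d) {k : ℕ} (hk : k < d) :
    S.u (v.take (k + 1)) + S.a (v.take (k + 1)) ≤ 1 := by
  obtain ⟨i, hi, h⟩ := exists_take_succ_eq hv hk
  rw [h]
  exact S.u_add_a_le_one hk (take_mem_treeWords hv hk.le) hi

theorem a_take_succ_le {v : List ℕ} (hv : v ∈ S.words d) {k : ℕ} (hk : k + 1 < d) :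
    S.a (v.take (k + 2)) ≤ S.a (v.take (k + 1)) := by
  obtain ⟨i, hi, h⟩ := exists_take_succ_eq hv hk
  rw [h]
  exact S.a_le (k + 1) hk (by omega) _ (take_mem_treeWords hv hk.le) i hi

/-- As the alphabet is finite, the contraction ratios are bounded away from `0` and `1`. -/
theorem exists_a_take_bounds : ∃ α β : ℝ, 0 < α ∧ 0 < β ∧ β < 1 ∧ ∀ v ∈ S.words d, ∀ k < d,
    α ≤ S.a (v.take (k + 1)) ∧ S.a (v.take (k + 1)) ≤ β := by
  have key : ∀ f : List ℕ × ℕ → ℝ, (∀ x ∈ S.words d ×ˢ range d, f x < 1) →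
      ∃ β : ℝ, 0 < β ∧ β < 1 ∧ ∀ x ∈ S.words d ×ˢ range d, f x ≤ β := by
    intro f hf
    obtain h | h := (S.words d ×ˢ range d).eq_empty_or_nonempty
    · exact ⟨1 / 2, by norm_num, by norm_num, by simp [h]⟩
    · obtain ⟨x, hx, hmax⟩ := exists_max_image _ f h
      refine ⟨max (f x) (1 / 2), by simp, max_lt (hf x hx) (by norm_num), fun y hy => ?_⟩
      exact (hmax y hy).trans (le_max_left _ _)
  obtain ⟨β, hβ0, hβ1, hβ⟩ := key (fun x => S.a (x.1.take (x.2 + 1))) fun x hx => by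
    rw [mem_product, mem_range] at hx
    exact S.a_take_lt_one hx.1 hx.2
  obtain ⟨α, -, hα1, hα⟩ := key (fun x => 1 - S.a (x.1.take (x.2 + 1))) fun x hx => by
    rw [mem_product, mem_range] at hx
    linarith [S.a_take_pos hx.1 hx.2]
  refine ⟨1 - α, β, by linarith, hβ0, hβ1, fun v hv k hk => ?_⟩
  have hmem : (v, k) ∈ S.words d ×ˢ range d := by simp [hv, hk]
  exact ⟨by linarith [hα _ hmem], hβ _ hmem⟩

/-! ### Nested intervals in one coordinate -/

/-- The length of the interval obtained by composing the maps `x ↦ a x + u` of the first `n` terms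
of the sequence `v` of words. -/
noncomputable def scale (v : ℕ → List ℕ) (n : ℕ) : ℝ := ∏ j ∈ range n, S.a (v j)

/-- The left end point of the interval obtained by composing the maps `x ↦ a x + u` of the first
`n` terms of the sequence `v` of words. -/
noncomputable def left (v : ℕ → List ℕ) (n : ℕ) : ℝ :=
  ∑ j ∈ range n, S.scale v j * S.u (v j)

theorem scale_zero (v : ℕ → List ℕ) : S.scale v 0 = 1 := by simp [scale]

theorem scale_succ (v : ℕ → List ℕ) (n : ℕ) : S.scale v (n + 1) = S.scale v n * S.a (v n) := by
  simp [scale, prod_range_succ]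

theorem left_succ (v : ℕ → List ℕ) (n : ℕ) :
    S.left v (n + 1) = S.left v n + S.scale v n * S.u (v n) := by
  simp [left, sum_range_succ]

theorem scale_congr {v v' : ℕ → List ℕ} {n : ℕ} (h : ∀ j < n, v j = v' j) :
    S.scale v n = S.scale v' n :=
  prod_congr rfl fun j hj => by rw [h j (mem_range.1 hj)]

theorem left_congr {v v' : ℕ → List ℕ} {n : ℕ} (h : ∀ j < n, v j = v' j) :
    S.left v n = S.left v' n :=
  sum_congr rfl fun j hj => by
    rw [mem_range] at hj
    rw [h j hj, S.scale_congr fun i hi => h i (hi.trans hj)]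

/-- A sequence of letters of the alphabet. -/
def IsCode (ω : ℕ → List ℕ) : Prop := ∀ j, ω j ∈ S.words d

/-- The sequence of prefixes of length `k + 1` of the terms of `ω`. -/
def prefixes (k : ℕ) (ω : ℕ → List ℕ) (j : ℕ) : List ℕ := (ω j).take (k + 1)

variable {S} {ω ω' : ℕ → List ℕ} {k : ℕ}

theorem IsCode.scale_pos (hω : S.IsCode ω) (hk : k < d) (n : ℕ) :
    0 < S.scale (prefixes k ω) n :=
  prod_pos fun j _ => S.a_take_pos (hω j) hk

theorem IsCode.left_monotone (hω : S.IsCode ω) (hk : k < d) :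
    Monotone (S.left (prefixes k ω)) := by
  refine monotone_nat_of_le_succ fun n => ?_
  rw [left_succ]
  exact le_add_of_nonneg_right
    (mul_nonneg (hω.scale_pos hk n).le (S.u_take_nonneg (hω n) hk))

theorem IsCode.right_antitone (hω : S.IsCode ω) (hk : k < d) :
    Antitone fun n => S.left (prefixes k ω) n + S.scale (prefixes k ω) n := by
  refine antitone_nat_of_succ_le fun n => ?_
  rw [left_succ, scale_succ]
  have h1 := S.u_add_a_take_le_one (hω n) hk
  have h2 := (hω.scale_pos hk n).le
  simp only [prefixes] at *
  nlinarith

theorem IsCode.scale_prefixes_succ_le (hω : S.IsCode ω) (hk : k + 1 < d) (n : ℕ) :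
    S.scale (prefixes (k + 1) ω) n ≤ S.scale (prefixes k ω) n :=
  prod_le_prod (fun j _ => (S.a_take_pos (hω j) hk).le) fun j _ => S.a_take_succ_le (hω j) hk

/-- If the half-open intervals of levels `n` and `n'` of two codes in one coordinate meet and the
codes have the same prefixes of length `k` up to the smaller level, then they have the same
prefixes of length `k + 1` up to that level. -/
theorem IsCode.take_eq_of_mem_Ico (hω : S.IsCode ω) (hω' : S.IsCode ω') (hk : k < d) {n n' : ℕ}
    (hpre : ∀ j, j < n → j < n' → (ω j).take k = (ω' j).take k) {x : ℝ}
    (hx : x ∈ Set.Ico (S.left (prefixes k ω) n)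
      (S.left (prefixes k ω) n + S.scale (prefixes k ω) n))
    (hx' : x ∈ Set.Ico (S.left (prefixes k ω') n')
      (S.left (prefixes k ω') n' + S.scale (prefixes k ω') n')) :
    ∀ j, j < n → j < n' → (ω j).take (k + 1) = (ω' j).take (k + 1) := by
  intro j
  induction j using Nat.strong_induction_on with
  | _ j ih =>
  intro hj hj'
  have hagree : ∀ i < j, prefixes k ω i = prefixes k ω' i := fun i hi =>
    ih i hi (hi.trans hj) (hi.trans hj')
  have b1 := (hω.left_monotone hk (Nat.succ_le_of_lt hj)).trans hx.1
  have b2 := hx.2.trans_le (hω.right_antitone hk (Nat.succ_le_of_lt hj))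
  have b3 := (hω'.left_monotone hk (Nat.succ_le_of_lt hj')).trans hx'.1
  have b4 := hx'.2.trans_le (hω'.right_antitone hk (Nat.succ_le_of_lt hj'))
  simp only [Nat.succ_eq_add_one, left_succ, scale_succ] at b1 b2 b3 b4
  rw [← S.scale_congr hagree, ← S.left_congr hagree] at b3 b4
  have hs := hω.scale_pos hk j
  obtain ⟨i, hi, hvi⟩ := exists_take_succ_eq (hω j) hk
  obtain ⟨i', hi', hvi'⟩ := exists_take_succ_eq (hω' j) hk
  rw [← hpre j hj hj'] at hi' hvi'
  simp only [prefixes] at *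
  rw [hvi] at b1 b2
  rw [hvi'] at b3 b4
  rw [hvi, hvi']
  congr 2
  refine S.child_unique hk (take_mem_treeWords (hω j) hk.le) hi hi'
    (y := (x - S.left (prefixes k ω) j) / S.scale (prefixes k ω) j) ?_ ?_ ?_ ?_
  · rw [le_div_iff₀ hs]; linarith
  · rw [div_lt_iff₀ hs]; linarith
  · rw [le_div_iff₀ hs]; linarith
  · rw [div_lt_iff₀ hs]; linarith

/-! ### The coding map -/

section Coding

open Filter Topology

variable {d : ℕ} (S : SelfAffineSponge d)

/-- The coordinate, governed by the prefixes of length `k + 1`, of the point coded by `ω`: the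
limit of the nondecreasing sequence of left end points. -/
noncomputable def coord (k : ℕ) (ω : ℕ → List ℕ) : ℝ := ⨆ n, S.left (prefixes k ω) n

/-- The point of `ℝᵈ` coded by `ω`. The coordinate `j` is governed by the prefixes of length
`d - j = (d - 1 - j) + 1`. -/
noncomputable def point (ω : ℕ → List ℕ) : EuclideanSpace ℝ (Fin d) :=
  WithLp.toLp 2 fun j : Fin d => S.coord (d - 1 - j) ω

variable {S} {ω ω' : ℕ → List ℕ} {k : ℕ}

theorem IsCode.bddAbove_left (hω : S.IsCode ω) (hk : k < d) :
    BddAbove (Set.range (S.left (prefixes k ω))) := by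
  refine ⟨1, ?_⟩
  rintro _ ⟨n, rfl⟩
  have h := hω.right_antitone hk (Nat.zero_le n)
  simp only [left, scale_zero, range_zero, sum_empty, zero_add] at h
  have := (hω.scale_pos hk n).le
  simp only [left]
  linarith

theorem IsCode.tendsto_left (hω : S.IsCode ω) (hk : k < d) :
    Tendsto (S.left (prefixes k ω)) atTop (𝓝 (S.coord k ω)) :=
  tendsto_atTop_ciSup (hω.left_monotone hk) (hω.bddAbove_left hk)

theorem IsCode.left_le_coord (hω : S.IsCode ω) (hk : k < d) (n : ℕ) :
    S.left (prefixes k ω) n ≤ S.coord k ω :=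
  le_ciSup (hω.bddAbove_left hk) n

theorem IsCode.coord_le_right (hω : S.IsCode ω) (hk : k < d) (n : ℕ) :
    S.coord k ω ≤ S.left (prefixes k ω) n + S.scale (prefixes k ω) n := by
  refine ciSup_le fun n' => ?_
  calc S.left (prefixes k ω) n' ≤ S.left (prefixes k ω) (max n n') :=
        hω.left_monotone hk (le_max_right _ _)
    _ ≤ S.left (prefixes k ω) (max n n') + S.scale (prefixes k ω) (max n n') :=
        le_add_of_nonneg_right (hω.scale_pos hk _).le
    _ ≤ _ := hω.right_antitone hk (le_max_left n n')

theorem IsCode.tendsto_scale (hω : S.IsCode ω) (hk : k < d) :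
    Tendsto (S.scale (prefixes k ω)) atTop (𝓝 0) := by
  obtain ⟨α, β, -, hβ0, hβ1, hβ⟩ := S.exists_a_take_bounds
  refine squeeze_zero (fun n => (hω.scale_pos hk n).le) (fun n => ?_)
    (tendsto_pow_atTop_nhds_zero_of_lt_one hβ0.le hβ1)
  calc S.scale (prefixes k ω) n ≤ ∏ _j ∈ range n, β :=
        prod_le_prod (fun j _ => (S.a_take_pos (hω j) hk).le) fun j _ => (hβ _ (hω j) k hk).2
    _ = β ^ n := by simp

/-- The composition of the maps of the first `n` letters of a code, which has linear parts `scale` and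
translation parts `left`, maps the limit set into itself. -/
theorem IsLimitSet.image_mem {Λ : Set (EuclideanSpace ℝ (Fin d))} (hΛ : S.IsLimitSet Λ)
    (hω : S.IsCode ω) (n : ℕ) {x : EuclideanSpace ℝ (Fin d)} (hx : x ∈ Λ) :
    (WithLp.toLp 2 fun j : Fin d => S.left (prefixes (d - 1 - j) ω) n +
      S.scale (prefixes (d - 1 - j) ω) n * x j : EuclideanSpace ℝ (Fin d)) ∈ Λ := by
  induction n generalizing x with
  | zero => simpa [left, scale] using hx
  | succ n ih =>
    have hmem : S.affineMap (ω n) x ∈ Λ := by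
      rw [hΛ.eq_iUnion]
      exact Set.mem_biUnion (hω n) (Set.mem_image_of_mem _ hx)
    convert ih hmem using 3 with j
    have hj : d - 1 - (j : ℕ) + 1 = d - j := by omega
    simp only [left_succ, scale_succ, affineMap, prefixes, hj]
    ring

theorem IsLimitSet.point_mem {Λ : Set (EuclideanSpace ℝ (Fin d))} (hΛ : S.IsLimitSet Λ)
    (hω : S.IsCode ω) : S.point ω ∈ Λ := by
  obtain ⟨x, hx⟩ := hΛ.nonempty
  refine hΛ.isCompact.isClosed.mem_of_tendsto (b := atTop) ?_
    (Eventually.of_forall fun n => hΛ.image_mem hω n hx)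
  refine ((PiLp.continuous_toLp 2 _).tendsto _).comp (tendsto_pi_nhds.2 fun j => ?_)
  have hj : d - 1 - (j : ℕ) < d := by omega
  simpa using (hω.tendsto_left hj).add ((hω.tendsto_scale hj).mul_const (x j))

end Coding

/-! ### Approximate cubes -/

section Cubes

variable {d : ℕ} (S : SelfAffineSponge d)

/-- The first level at which the intervals of `ω` in the coordinate governed by the prefixes of
length `k + 1` have length at most `r`. -/
noncomputable def level (r : ℝ) (k : ℕ) (ω : ℕ → List ℕ) : ℕ :=
  sInf {n | S.scale (prefixes k ω) n ≤ r}

/-- In each coordinate, the first point of the lattice `δ ℤ` that is at least the left end point of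
the interval of `ω` of length about `r`. -/
noncomputable def latticePoint (r δ : ℝ) (ω : ℕ → List ℕ) (k : Fin d) : ℤ :=
  ⌈S.left (prefixes k ω) (S.level r k ω) / δ⌉

variable {S} {ω ω' : ℕ → List ℕ} {k : ℕ} {r α : ℝ}

theorem level_le {n : ℕ} (h : S.scale (prefixes k ω) n ≤ r) : S.level r k ω ≤ n :=
  Nat.sInf_le h

theorem IsCode.scale_level_le (hω : S.IsCode ω) (hk : k < d) (hr : 0 < r) :
    S.scale (prefixes k ω) (S.level r k ω) ≤ r := by
  refine Nat.sInf_mem (s := {n | S.scale (prefixes k ω) n ≤ r}) ?_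
  exact ((hω.tendsto_scale hk).eventually (eventually_le_nhds hr)).exists

theorem IsCode.level_succ_le (hω : S.IsCode ω) (hk : k + 1 < d) (hr : 0 < r) :
    S.level r (k + 1) ω ≤ S.level r k ω :=
  level_le ((hω.scale_prefixes_succ_le hk _).trans (hω.scale_level_le (by omega) hr))

/-- The intervals of length at most `r` are not much shorter than `r`. -/
theorem IsCode.le_scale_level (hω : S.IsCode ω) (hk : k < d) (hr : 0 < r) (hr1 : r ≤ 1)
    (hα : ∀ v ∈ S.words d, ∀ k < d, α ≤ S.a (v.take (k + 1))) :
    α * r ≤ S.scale (prefixes k ω) (S.level r k ω) := by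
  have hα1 := hα _ (hω 0) k hk
  have ha1 := S.a_take_lt_one (hω 0) hk
  rcases h : S.level r k ω with - | n
  · rw [scale_zero]
    nlinarith
  · have hn : r < S.scale (prefixes k ω) n := by
      by_contra! hle
      have := level_le hle
      omega
    rw [scale_succ]
    have h1 : α ≤ S.a (prefixes k ω n) := hα _ (hω n) k hk
    have h2 : 0 < S.a (prefixes k ω n) := S.a_take_pos (hω n) hk
    nlinarith

theorem IsCode.le_level (hω : S.IsCode ω) (hk : k < d) (hr : 0 < r) (hα0 : 0 < α) (hα1 : α ≤ 1)
    (hα : ∀ v ∈ S.words d, ∀ k < d, α ≤ S.a (v.take (k + 1))) {N : ℕ} (hN : r < α ^ N) :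
    N ≤ S.level r k ω := by
  by_contra! hlt
  have h1 : α ^ S.level r k ω ≤ S.scale (prefixes k ω) (S.level r k ω) := by
    calc α ^ S.level r k ω = ∏ _j ∈ range (S.level r k ω), α := by simp
      _ ≤ _ := prod_le_prod (fun j _ => hα0.le) fun j _ => hα _ (hω j) k hk
  have h2 := pow_le_pow_of_le_one hα0.le hα1 hlt.le
  linarith [hω.scale_level_le hk hr]

theorem IsCode.level_eq_of_take_eq (hω : S.IsCode ω) (hω' : S.IsCode ω') (hk : k < d)
    (hr : 0 < r) (h : ∀ j, j < S.level r k ω → j < S.level r k ω' →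
      (ω j).take (k + 1) = (ω' j).take (k + 1)) :
    S.level r k ω = S.level r k ω' := by
  rcases le_total (S.level r k ω) (S.level r k ω') with hle | hle
  · refine le_antisymm hle (level_le ?_)
    rw [← S.scale_congr (v := prefixes k ω) (v' := prefixes k ω') fun j hj =>
      h j hj (hj.trans_le hle)]
    exact hω.scale_level_le hk hr
  · refine le_antisymm (level_le ?_) hle
    rw [S.scale_congr (v := prefixes k ω) (v' := prefixes k ω') fun j hj =>
      h j (hj.trans_le hle) hj]
    exact hω'.scale_level_le hk hr

theorem IsCode.lattice_mem_Ico (hω : S.IsCode ω) (hr : 0 < r) (hr1 : r ≤ 1) (hα0 : 0 < α)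
    (hα : ∀ v ∈ S.words d, ∀ k < d, α ≤ S.a (v.take (k + 1))) (k : Fin d) :
    α * r * S.latticePoint r (α * r) ω k ∈ Set.Ico (S.left (prefixes k ω) (S.level r k ω))
      (S.left (prefixes k ω) (S.level r k ω) + S.scale (prefixes k ω) (S.level r k ω)) := by
  have hδ : 0 < α * r := mul_pos hα0 hr
  have h1 := Int.le_ceil (S.left (prefixes k ω) (S.level r k ω) / (α * r))
  have h2 := Int.ceil_lt_add_one (S.left (prefixes k ω) (S.level r k ω) / (α * r))
  have h3 := hω.le_scale_level k.2 hr hr1 hα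
  rw [div_le_iff₀ hδ] at h1
  rw [← sub_lt_iff_lt_add, lt_div_iff₀ hδ] at h2
  unfold latticePoint
  exact ⟨by linarith, by linarith⟩

/-- Codes with the same lattice point lie in the same approximate cube: the coordinates are treated
one after the other, starting from the one governed by the shortest prefixes. -/
theorem IsCode.take_eq_of_latticePoint_eq (hω : S.IsCode ω) (hω' : S.IsCode ω') (hr : 0 < r)
    (hr1 : r ≤ 1) (hα0 : 0 < α)
    (hα : ∀ v ∈ S.words d, ∀ k < d, α ≤ S.a (v.take (k + 1)))
    (h : S.latticePoint r (α * r) ω = S.latticePoint r (α * r) ω') :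
    ∀ k < d, ∀ j < S.level r k ω, (ω j).take (k + 1) = (ω' j).take (k + 1) := by
  suffices H : ∀ k < d, S.level r k ω = S.level r k ω' ∧
      ∀ j < S.level r k ω, (ω j).take (k + 1) = (ω' j).take (k + 1) from
    fun k hk => (H k hk).2
  have step : ∀ k < d, (∀ j, j < S.level r k ω → j < S.level r k ω' →
      (ω j).take k = (ω' j).take k) → S.level r k ω = S.level r k ω' ∧
      ∀ j < S.level r k ω, (ω j).take (k + 1) = (ω' j).take (k + 1) := by
    intro k hk hpre
    have hx := hω.lattice_mem_Ico hr hr1 hα0 hα ⟨k, hk⟩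
    have hx' := hω'.lattice_mem_Ico hr hr1 hα0 hα ⟨k, hk⟩
    rw [← h] at hx'
    have key := hω.take_eq_of_mem_Ico hω' hk hpre hx hx'
    have hlev := hω.level_eq_of_take_eq hω' hk hr key
    exact ⟨hlev, fun j hj => key j hj (hlev ▸ hj)⟩
  intro k
  induction k with
  | zero => exact fun hk => step 0 hk fun j _ _ => by simp
  | succ k ih =>
    intro hk
    refine step (k + 1) hk fun j hj _ => (ih (by omega)).2 j ?_
    exact hj.trans_le (hω.level_succ_le hk hr)

/-- A set of codes whose points lie at mutual distances at most `r` meets a number of approximate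
cubes of size `r` that is bounded independently of `r`. -/
theorem exists_finset_latticePoint_mem (hr : 0 < r) (hα0 : 0 < α) {E : Set (ℕ → List ℕ)}
    (hE : ∀ ω ∈ E, S.IsCode ω)
    (hdist : ∀ ω ∈ E, ∀ ω' ∈ E, ∀ k < d, |S.coord k ω - S.coord k ω'| ≤ r) :
    ∃ T : Finset (Fin d → ℤ), #T ≤ (⌈3 / α⌉₊ + 2) ^ d ∧
      ∀ ω ∈ E, S.latticePoint r (α * r) ω ∈ T := by
  obtain rfl | ⟨ω₀, h₀⟩ := E.eq_empty_or_nonempty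
  · exact ⟨∅, by simp, by simp⟩
  have hδ : 0 < α * r := mul_pos hα0 hr
  refine ⟨Fintype.piFinset fun k : Fin d => Icc ⌈(S.coord k ω₀ - 2 * r) / (α * r)⌉
    ⌈(S.coord k ω₀ + r) / (α * r)⌉, ?_, fun ω hω => ?_⟩
  · rw [Fintype.card_piFinset]
    refine (prod_le_pow_card _ _ (⌈3 / α⌉₊ + 2) fun k _ => ?_).trans (by simp)
    rw [Int.card_Icc, Int.toNat_le, ← Int.cast_le (R := ℝ)]
    have h1 := Int.le_ceil ((S.coord k ω₀ - 2 * r) / (α * r))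
    have h2 := Int.ceil_lt_add_one ((S.coord k ω₀ + r) / (α * r))
    have h3 := Nat.le_ceil (3 / α)
    have h4 : (S.coord k ω₀ + r) / (α * r) - (S.coord k ω₀ - 2 * r) / (α * r) = 3 / α := by
      field_simp
      ring
    push_cast
    linarith
  · refine Fintype.mem_piFinset.2 fun k => mem_Icc.2 ⟨?_, ?_⟩
    all_goals
      refine Int.ceil_mono (div_le_div_of_nonneg_right ?_ hδ.le)
      have h1 := abs_le.1 (hdist ω hω ω₀ h₀ k k.2)
      have h2 := (hE ω hω).left_le_coord k.2 (S.level r k ω)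
      have h3 := (hE ω hω).coord_le_right k.2 (S.level r k ω)
      have h4 := (hE ω hω).scale_level_le k.2 hr
      linarith

end Cubes

end SelfAffineSponge

/-! ### The mass distribution principle -/

section MassDistribution

open MeasureTheory Filter Topology
open scoped ENNReal

/-- If a measure not vanishing on `A` gives closed sets of diameter at most `r` measure at most
`K r ^ s`, for all small `r`, then `A` has Hausdorff dimension at least `s`. -/
theorem ofReal_le_dimH_of_measure_le {X : Type*} [EMetricSpace X] [MeasurableSpace X]
    [BorelSpace X] (ν : Measure X) {A : Set X} (hA : ν A ≠ 0) {s r₀ : ℝ} (hs : 0 < s)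
    (hr₀ : 0 < r₀) {K : ℝ≥0∞} (hK : K ≠ ∞)
    (h : ∀ r, 0 < r → r < r₀ → ∀ E : Set X, IsClosed E → Metric.ediam E ≤ ENNReal.ofReal r →
      ν E ≤ K * ENNReal.ofReal (r ^ s)) :
    ENNReal.ofReal s ≤ dimH A := by
  have hK1 : K + 1 ≠ ∞ := by simp [hK]
  have hK0 : K + 1 ≠ 0 := by simp
  have hle : (K + 1)⁻¹ • ν ≤ Measure.hausdorffMeasure s := by
    refine Measure.le_hausdorffMeasure s _ (ENNReal.ofReal (r₀ / 2)) (by simpa using hr₀) ?_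
    intro E hE
    have htop : Metric.ediam E ≠ ∞ := ne_top_of_le_ne_top ENNReal.ofReal_ne_top hE
    set D := (Metric.ediam E).toReal with hD
    have hDE : ENNReal.ofReal D = Metric.ediam E := ENNReal.ofReal_toReal htop
    have hD0 : 0 ≤ D := ENNReal.toReal_nonneg
    have hDr : D ≤ r₀ / 2 := ENNReal.toReal_le_of_le_ofReal (by linarith) hE
    -- Radii `r > D` are used, since `h` says nothing about `r = 0`.
    have hlim : Tendsto (fun r : ℝ => K * ENNReal.ofReal (r ^ s)) (𝓝[>] D)
        (𝓝 (K * ENNReal.ofReal (D ^ s))) := by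
      refine ENNReal.Tendsto.const_mul (ENNReal.tendsto_ofReal ?_) (Or.inr hK)
      exact ((Real.continuousAt_rpow_const D s (Or.inr hs.le)).tendsto).mono_left
        nhdsWithin_le_nhds
    have hbound : ν E ≤ K * ENNReal.ofReal (D ^ s) := by
      refine ge_of_tendsto hlim ?_
      filter_upwards [Ioo_mem_nhdsGT (show D < r₀ by linarith)] with r hr
      refine (measure_mono subset_closure).trans
        (h r (hD0.trans_lt hr.1) hr.2 _ isClosed_closure ?_)
      rw [Metric.ediam_closure, ← hDE]
      exact ENNReal.ofReal_le_ofReal hr.1.le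
    rw [Measure.smul_apply, smul_eq_mul, ENNReal.inv_mul_le_iff hK0 hK1, ← hDE,
      ENNReal.ofReal_rpow_of_nonneg hD0 hs.le]
    exact hbound.trans (mul_le_mul_left (by simp) _)
  refine le_dimH_of_hausdorffMeasure_ne_zero (d := s.toNNReal) ?_
  rw [Real.coe_toNNReal s hs.le]
  intro h0
  have := hle A
  rw [h0, Measure.smul_apply, smul_eq_mul] at this
  simp [hA, hK] at this

end MassDistribution

namespace SelfAffineSponge

/-! ### Bernoulli measures on the space of codes -/

/-- A probability vector on the whole alphabet, together with its marginals on shorter words. -/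
structure Weights {d : ℕ} (S : SelfAffineSponge d) where
  q : List ℕ → ℝ
  nonneg : ∀ w ∈ S.words d, 0 ≤ q w
  marginal : ∀ k < d, ∀ w ∈ S.words k, q w = ∑ i ∈ range (S.m w), q (w ++ [i])
  total : q [] = 1

namespace Weights

open MeasureTheory ProbabilityTheory Filter Topology
open scoped ENNReal

variable {d : ℕ} {S : SelfAffineSponge d} (W : S.Weights)

/-- The letters of positive weight. Discarding the others makes the logarithms of all the weights
that occur meaningful. -/
abbrev Letter : Type := {w : List ℕ // w ∈ S.words d ∧ 0 < W.q w}

noncomputable instance : Fintype W.Letter :=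
  Fintype.subtype ((S.words d).filter fun w => 0 < W.q w) (by simp)

instance : MeasurableSpace W.Letter := ⊤

instance : DiscreteMeasurableSpace W.Letter := ⟨fun _ => trivial⟩

theorem sum_letter (f : List ℕ → ℝ) :
    ∑ v : W.Letter, W.q v.1 * f v.1 = ∑ v ∈ S.words d, W.q v * f v := by
  rw [← sum_filter_of_ne (p := fun v => 0 < W.q v)]
  · exact (sum_subtype _ (by simp) fun v => W.q v * f v).symm
  · intro v hv hne
    exact lt_of_le_of_ne (W.nonneg v hv) fun h => hne (by simp [← h])

theorem sum_letter_take {k : ℕ} (hk : k ≤ d) (f : List ℕ → ℝ) :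
    ∑ v : W.Letter, W.q v.1 * f (v.1.take k) = ∑ w ∈ S.words k, W.q w * f w := by
  rw [W.sum_letter fun v => f (v.take k)]
  exact sum_treeWords_mul_take hk W.marginal f

theorem q_pos_take (v : W.Letter) {k : ℕ} (hk : k ≤ d) : 0 < W.q (v.1.take k) := by
  have h := W.sum_letter_take hk fun w => if w = v.1.take k then 1 else 0
  simp only [mul_ite, mul_one, mul_zero, sum_ite_eq'] at h
  rw [if_pos (show v.1.take k ∈ S.words k from take_mem_treeWords v.2.1 hk)] at h
  rw [← h]
  refine sum_pos' (fun x _ => ?_) ⟨v, mem_univ v, by simpa using v.2.2⟩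
  split_ifs
  exacts [x.2.2.le, le_rfl]

/-- The probability measure on the letters with the given weights. -/
noncomputable def pmf : PMF W.Letter :=
  PMF.ofFintype (fun v => ENNReal.ofReal (W.q v.1)) (by
    rw [← ENNReal.ofReal_sum_of_nonneg fun v _ => v.2.2.le]
    have h := W.sum_letter_take (Nat.zero_le d) fun _ => 1
    simp only [mul_one, words, treeWords, sum_singleton, W.total] at h
    simp [h])

theorem sum_q_mul_log_a_neg {k : ℕ} (hk : k < d) :
    ∑ w ∈ S.words (k + 1), W.q w * Real.log (S.a w) < 0 := by
  rw [← W.sum_letter_take (show k + 1 ≤ d by omega) fun w => Real.log (S.a w)]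
  refine sum_neg (fun v _ => mul_neg_of_pos_of_neg v.2.2
    (Real.log_neg (S.a_take_pos v.2.1 hk) (S.a_take_lt_one v.2.1 hk))) ?_
  obtain ⟨v⟩ := W.pmf.support_nonempty
  exact ⟨v, mem_univ v⟩

theorem pmf_toMeasure_take {k : ℕ} (hk : k ≤ d) {w : List ℕ} (hw : w ∈ S.words k) :
    W.pmf.toMeasure {v | v.1.take k = w} = ENNReal.ofReal (W.q w) := by
  have h := W.sum_letter_take hk fun w' => if w' = w then 1 else 0
  simp only [mul_ite, mul_one, mul_zero, sum_ite_eq', if_pos hw] at h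
  rw [PMF.toMeasure_apply_fintype, ← h, ENNReal.ofReal_sum_of_nonneg]
  · refine sum_congr rfl fun v _ => ?_
    by_cases hv : v.1.take k = w <;> simp [Set.indicator, hv, pmf]
  · intro v _
    split_ifs
    exacts [v.2.2.le, le_rfl]

/-- The Bernoulli measure on sequences of letters. -/
noncomputable def bernoulli : Measure (ℕ → W.Letter) :=
  Measure.infinitePi fun _ => W.pmf.toMeasure

instance : IsProbabilityMeasure W.bernoulli := by
  unfold bernoulli
  infer_instance

/-- By the strong law of large numbers, the partial sums along almost every code of a function of
negative mean are eventually nonpositive. -/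
theorem ae_eventually_sum_nonpos (f : W.Letter → ℝ) (hf : ∑ v, W.q v.1 * f v < 0) :
    ∀ᵐ ω ∂W.bernoulli, ∀ᶠ n in atTop, ∑ j ∈ range n, f (ω j) ≤ 0 := by
  have hmp : ∀ i, MeasurePreserving (Function.eval i) W.bernoulli W.pmf.toMeasure := fun i =>
    measurePreserving_eval_infinitePi (fun _ : ℕ => W.pmf.toMeasure) i
  have hfm : Measurable f := Measurable.of_discrete
  have hint : Integrable f W.pmf.toMeasure := .of_finite
  have hmean : ∫ ω, f (ω 0) ∂W.bernoulli = ∑ v, W.q v.1 * f v := by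
    rw [← (hmp 0).map_eq] at hint
    have := integral_map (μ := W.bernoulli) (φ := Function.eval 0) (f := f)
      (hmp 0).measurable.aemeasurable hint.aestronglyMeasurable
    rw [(hmp 0).map_eq, PMF.integral_eq_sum] at this
    change _ = ∫ ω, f (ω 0) ∂W.bernoulli at this
    rw [← this]
    refine sum_congr rfl fun v _ => ?_
    simp [pmf, ENNReal.toReal_ofReal v.2.2.le]
  have hlaw := strong_law_ae_real (μ := W.bernoulli) (fun j ω => f (ω j))
    ((hmp 0).integrable_comp_of_integrable hint)
    (fun i j hij => (iIndepFun_infinitePi (P := fun _ : ℕ => W.pmf.toMeasure)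
      (X := fun _ => f) fun _ => hfm).indepFun hij)
    (fun i => ⟨(hfm.comp (measurable_pi_apply i)).aemeasurable,
      (hfm.comp (measurable_pi_apply 0)).aemeasurable, by
        have : ∀ i, W.bernoulli.map (fun ω => f (ω i)) = W.pmf.toMeasure.map f := fun i => by
          rw [← (hmp i).map_eq, Measure.map_map hfm (hmp i).measurable]
          rfl
        rw [this, this]⟩)
  filter_upwards [hlaw] with ω hω
  rw [hmean] at hω
  filter_upwards [hω.eventually (gt_mem_nhds hf), eventually_gt_atTop 0] with n hn hn0
  have hn0' : (0 : ℝ) < n := by exact_mod_cast hn0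
  rw [div_lt_iff₀ hn0', zero_mul] at hn
  exact hn.le

/-- The logarithm of the conditional probability of the prefix of length `k + 1` given the prefix of
length `k`. -/
noncomputable def logCond (k : ℕ) (v : List ℕ) : ℝ :=
  Real.log (W.q (v.take (k + 1))) - Real.log (W.q (v.take k))

theorem sum_logCond (v : List ℕ) (K : ℕ) :
    ∑ k ∈ range K, W.logCond k v = Real.log (W.q (v.take K)) := by
  simp only [logCond]
  rw [sum_range_sub fun k => Real.log (W.q (v.take k))]
  simp [W.total]

/-- A bound for the measure of an approximate cube: in the position `j` the cube prescribes the
prefix whose length is the number of the `k` with `j < L k`. -/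
theorem bernoulli_cube_le (ω : ℕ → W.Letter) {L : ℕ → ℕ} (hL : AntitoneOn L (Set.Iio d)) :
    W.bernoulli {ω' | ∀ k < d, ∀ j < L k, (ω j).1.take (k + 1) = (ω' j).1.take (k + 1)} ≤
      ENNReal.ofReal (Real.exp (∑ k ∈ range d, ∑ j ∈ range (L k), W.logCond k (ω j).1)) := by
  classical
  have hd := S.two_le
  set K : ℕ → ℕ := fun j => Nat.findGreatest (fun k => ∀ i < k, j < L i) d
  have hKd : ∀ j, K j ≤ d := fun j => Nat.findGreatest_le d
  have hK : ∀ j, ∀ i < K j, j < L i := fun j =>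
    Nat.findGreatest_spec (P := fun k => ∀ i < k, j < L i) (Nat.zero_le d) (by simp)
  have hK' : ∀ j, ∀ k < d, j < L k → k < K j := fun j k hk hj =>
    Nat.le_findGreatest (P := fun k => ∀ i < k, j < L i) hk fun i hi =>
      hj.trans_le (hL (show i < d by omega) hk (by omega))
  have hsub : {ω' : ℕ → W.Letter | ∀ k < d, ∀ j < L k,
      (ω j).1.take (k + 1) = (ω' j).1.take (k + 1)} ⊆
      Set.pi (range (L 0)) fun j => {v : W.Letter | v.1.take (K j) = (ω j).1.take (K j)} := by
    intro ω' hω' j _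
    have h := hKd j
    have h' := hK j
    show (ω' j).1.take (K j) = (ω j).1.take (K j)
    rcases hKj : K j with - | k
    · simp
    · exact (hω' k (by omega) j (h' k (by omega))).symm
  refine (measure_mono hsub).trans (le_of_eq ?_)
  rw [bernoulli, Measure.infinitePi_pi _ fun _ _ => MeasurableSet.of_discrete]
  have hterm : ∀ j, W.pmf.toMeasure {v : W.Letter | v.1.take (K j) = (ω j).1.take (K j)} =
      ENNReal.ofReal (Real.exp (∑ k ∈ range (K j), W.logCond k (ω j).1)) := fun j => by
    rw [W.pmf_toMeasure_take (hKd j) (take_mem_treeWords (ω j).2.1 (hKd j)), W.sum_logCond,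
      Real.exp_log (W.q_pos_take _ (hKd j))]
  simp only [hterm]
  rw [← ENNReal.ofReal_prod_of_nonneg fun _ _ => (Real.exp_pos _).le, ← Real.exp_sum]
  congr 2
  refine sum_comm' fun j k => ?_
  simp only [mem_range]
  constructor
  · rintro ⟨-, hk⟩
    exact ⟨hK j k hk, hk.trans_le (hKd j)⟩
  · rintro ⟨hj, hk⟩
    exact ⟨hj.trans_le (hL (show 0 < d by omega) hk (by omega)), hK' j k hk hj⟩

/-! ### The dimension of a Bernoulli measure -/

/-- The sequence of words underlying a sequence of letters of positive weight. -/
def code (ω : ℕ → W.Letter) (j : ℕ) : List ℕ := (ω j).1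

theorem isCode_code (ω : ℕ → W.Letter) : S.IsCode (W.code ω) := fun j => (ω j).2.1

theorem measurable_point : Measurable fun ω => S.point (W.code ω) := by
  have hf : ∀ (f : List ℕ → ℝ) (k j : ℕ),
      Measurable fun ω : ℕ → W.Letter => f (prefixes k (W.code ω) j) := fun f k j =>
    (Measurable.of_discrete (f := fun v : W.Letter => f (v.1.take (k + 1)))).comp
      (measurable_pi_apply j)
  refine (WithLp.measurable_toLp 2 _).comp (measurable_pi_lambda _ fun j => ?_)
  refine Measurable.iSup fun n => ?_
  unfold left scale
  exact Finset.measurable_fun_sum _ fun i _ =>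
    (Finset.measurable_fun_prod _ fun i' _ => hf S.a _ i').mul (hf S.u _ i)

/-- If `s k` is less than the ratio of the conditional entropy to the Lyapunov exponent in the
coordinate governed by the prefixes of length `k + 1` (both sides of that inequality being
multiplied by the negative exponent), then the Bernoulli measure of approximate cubes of size `r` is
at most a constant times `r ^ ∑ s k` on a set of codes of positive measure. -/
theorem exists_bernoulli_cube_le {s : ℕ → ℝ} {α : ℝ} (hα0 : 0 < α) (hα1 : α ≤ 1)
    (hα : ∀ v ∈ S.words d, ∀ k < d, α ≤ S.a (v.take (k + 1)))
    (hs : ∀ k < d, (∑ w ∈ S.words (k + 1), W.q w * Real.log (W.q w)) -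
      (∑ w ∈ S.words k, W.q w * Real.log (W.q w)) <
        s k * ∑ w ∈ S.words (k + 1), W.q w * Real.log (S.a w)) :
    ∃ G : Set (ℕ → W.Letter), W.bernoulli G ≠ 0 ∧ ∃ C r₀ : ℝ, 0 < r₀ ∧ r₀ ≤ 1 ∧
      ∀ ω ∈ G, ∀ r, 0 < r → r < r₀ →
        W.bernoulli {ω' | ∀ k < d, ∀ j < S.level r k (W.code ω),
          (ω j).1.take (k + 1) = (ω' j).1.take (k + 1)} ≤
        ENNReal.ofReal (C * r ^ ∑ k ∈ range d, s k) := by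
  -- The excess of the measure over the `s k`-th power of the length has negative mean growth rate.
  set f : ℕ → List ℕ → ℝ := fun k v => W.logCond k v - s k * Real.log (S.a (v.take (k + 1)))
    with hf
  have hae : ∀ᵐ ω ∂W.bernoulli, ∀ k ∈ range d, ∀ᶠ n in atTop, ∑ j ∈ range n, f k (ω j).1 ≤ 0 := by
    rw [eventually_all_finset]
    intro k hk
    rw [mem_range] at hk
    refine W.ae_eventually_sum_nonpos (fun v => f k v.1) ?_
    have h1 := W.sum_letter_take (show k + 1 ≤ d by omega) fun w => Real.log (W.q w)
    have h2 := W.sum_letter_take hk.le fun w => Real.log (W.q w)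
    have h3 := W.sum_letter_take (show k + 1 ≤ d by omega) fun w => Real.log (S.a w)
    have h4 : ∑ v : W.Letter, W.q v.1 * f k v.1 =
        ∑ v : W.Letter, W.q v.1 * Real.log (W.q (v.1.take (k + 1))) -
        ∑ v : W.Letter, W.q v.1 * Real.log (W.q (v.1.take k)) -
        s k * ∑ v : W.Letter, W.q v.1 * Real.log (S.a (v.1.take (k + 1))) := by
      rw [mul_sum, ← sum_sub_distrib, ← sum_sub_distrib]
      refine sum_congr rfl fun v _ => ?_
      simp only [hf, logCond]
      ring
    rw [h4, h1, h2, h3]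
    linarith [hs k hk]
  obtain ⟨N, hN⟩ : ∃ N : ℕ, W.bernoulli {ω | ∀ n ≥ N, ∀ k ∈ range d,
      ∑ j ∈ range n, f k (ω j).1 ≤ 0} ≠ 0 := by
    by_contra! hnull
    have h0 := measure_iUnion_null hnull
    have h1 : ∀ᵐ ω ∂W.bernoulli, False := by
      filter_upwards [hae, measure_eq_zero_iff_ae_notMem.1 h0] with ω hω hω'
      obtain ⟨N, hN⟩ := eventually_atTop.1 ((eventually_all_finset _).2 hω)
      exact hω' (Set.mem_iUnion.2 ⟨N, hN⟩)
    simpa using h1.exists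
  refine ⟨_, hN, Real.exp (∑ k ∈ range d, |s k| * |Real.log α|), α ^ N, by positivity,
    pow_le_one₀ hα0.le hα1, fun ω hω r hr hrN => ?_⟩
  have hcode := W.isCode_code ω
  have hr1 : r ≤ 1 := hrN.le.trans (pow_le_one₀ hα0.le hα1)
  have hanti : AntitoneOn (fun k => S.level r k (W.code ω)) (Set.Iio d) := by
    refine antitoneOn_of_succ_le Set.ordConnected_Iio fun k _ _ hk => ?_
    exact hcode.level_succ_le hk hr
  refine (W.bernoulli_cube_le ω hanti).trans (ENNReal.ofReal_le_ofReal ?_)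
  rw [Real.rpow_def_of_pos hr, ← Real.exp_add, Real.exp_le_exp, mul_sum, ← sum_add_distrib]
  refine sum_le_sum fun k hk => ?_
  have hkd := mem_range.1 hk
  set n := S.level r k (W.code ω) with hn
  have hsum := hω n (hcode.le_level hkd hr hα0 hα1 hα hrN) k hk
  have hlog : ∑ j ∈ range n, Real.log (S.a ((ω j).1.take (k + 1))) =
      Real.log (S.scale (prefixes k (W.code ω)) n) := by
    exact (Real.log_prod fun j _ => (S.a_take_pos (hcode j) hkd).ne').symm
  simp only [hf, sum_sub_distrib, ← mul_sum] at hsum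
  rw [hlog] at hsum
  have hpos := hcode.scale_pos hkd n
  have hup := Real.log_le_log hpos (hcode.scale_level_le hkd hr)
  have hlow := Real.log_le_log (mul_pos hα0 hr) (hcode.le_scale_level hkd hr hr1 hα)
  rw [Real.log_mul hα0.ne' hr.ne'] at hlow
  have hdiff : |Real.log (S.scale (prefixes k (W.code ω)) n) - Real.log r| ≤ |Real.log α| := by
    rw [abs_of_nonpos (by linarith), abs_of_nonpos (Real.log_nonpos hα0.le hα1)]
    linarith
  have hmul := (le_abs_self (s k * (Real.log (S.scale (prefixes k (W.code ω)) n) -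
    Real.log r))).trans ((abs_mul _ _).trans_le (mul_le_mul_of_nonneg_left hdiff (abs_nonneg _)))
  linarith

/-- The sponge has dimension at least `∑ s k` if every `s k` is less than the ratio of the conditional
entropy to the Lyapunov exponent in the corresponding coordinate. -/
theorem ofReal_sum_le_dimH {Λ : Set (EuclideanSpace ℝ (Fin d))} (hΛ : S.IsLimitSet Λ) {s : ℕ → ℝ}
    (hs : ∀ k < d, (∑ w ∈ S.words (k + 1), W.q w * Real.log (W.q w)) -
      (∑ w ∈ S.words k, W.q w * Real.log (W.q w)) <
        s k * ∑ w ∈ S.words (k + 1), W.q w * Real.log (S.a w)) :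
    ENNReal.ofReal (∑ k ∈ range d, s k) ≤ dimH Λ := by
  obtain hs0 | hs0 := le_or_gt (∑ k ∈ range d, s k) 0
  · simp [ENNReal.ofReal_of_nonpos hs0]
  obtain ⟨α', _, hα0', -, -, hα'⟩ := S.exists_a_take_bounds
  obtain ⟨α, hα0, hα1, hα⟩ : ∃ α : ℝ, 0 < α ∧ α ≤ 1 ∧
      ∀ v ∈ S.words d, ∀ k < d, α ≤ S.a (v.take (k + 1)) :=
    ⟨min α' 1, by positivity, min_le_right _ _, fun v hv k hk =>
      (min_le_left _ _).trans (hα' v hv k hk).1⟩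
  obtain ⟨G, hG, C, r₀, hr₀, hr₁, hcube⟩ := W.exists_bernoulli_cube_le hα0 hα1 hα hs
  set π : (ℕ → W.Letter) → EuclideanSpace ℝ (Fin d) := fun ω => S.point (W.code ω) with hπ
  have hπm : Measurable π := W.measurable_point
  refine ofReal_le_dimH_of_measure_le ((W.bernoulli.restrict G).map π) (A := Λ) ?_ hs0 hr₀
    (K := ((⌈3 / α⌉₊ + 2) ^ d : ℕ) * ENNReal.ofReal C)
    (ENNReal.mul_ne_top (ENNReal.natCast_ne_top _) ENNReal.ofReal_ne_top) ?_
  · have hΛm := hΛ.isCompact.isClosed.measurableSet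
    rw [Measure.map_apply hπm hΛm, Measure.restrict_apply (hπm hΛm)]
    have : π ⁻¹' Λ = Set.univ :=
      Set.eq_univ_of_forall fun ω => hΛ.point_mem (W.isCode_code ω)
    rwa [this, Set.univ_inter]
  · intro r hr hrr₀ E hE hdiam
    rw [Measure.map_apply hπm hE.measurableSet,
      Measure.restrict_apply (hπm hE.measurableSet)]
    obtain ⟨T, hTcard, hT⟩ := exists_finset_latticePoint_mem (S := S) hr hα0
      (E := W.code '' (π ⁻¹' E ∩ G)) (by rintro _ ⟨ω, -, rfl⟩; exact W.isCode_code ω) (by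
        rintro _ ⟨ω, hω, rfl⟩ _ ⟨ω', hω', rfl⟩ k hk
        have h1 : dist (π ω) (π ω') ≤ r := by
          rw [← ENNReal.ofReal_le_ofReal_iff hr.le, ← edist_dist]
          exact (Metric.edist_le_ediam_of_mem (show π ω ∈ E from hω.1) hω'.1).trans hdiam
        have h2 := (PiLp.norm_apply_le (π ω - π ω') ⟨d - 1 - k, by omega⟩).trans
          ((dist_eq_norm _ _).symm.le.trans h1)
        have hk' : d - 1 - (d - 1 - k) = k := by omega
        simpa [hπ, point, hk', Real.norm_eq_abs] using h2)
    have hcover : π ⁻¹' E ∩ G ⊆ ⋃ z ∈ T, {ω ∈ G | S.latticePoint r (α * r) (W.code ω) = z} :=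
      fun ω hω => Set.mem_biUnion (hT _ (Set.mem_image_of_mem _ hω)) ⟨hω.2, rfl⟩
    calc W.bernoulli (π ⁻¹' E ∩ G)
        ≤ ∑ z ∈ T, W.bernoulli {ω ∈ G | S.latticePoint r (α * r) (W.code ω) = z} :=
          (measure_mono hcover).trans (measure_biUnion_finset_le _ _)
      _ ≤ ∑ z ∈ T, ENNReal.ofReal (C * r ^ ∑ k ∈ range d, s k) := by
          refine sum_le_sum fun z _ => ?_
          obtain h | ⟨ω, hωG, rfl⟩ :=
            {ω ∈ G | S.latticePoint r (α * r) (W.code ω) = z}.eq_empty_or_nonempty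
          · simp [h]
          · refine (measure_mono ?_).trans (hcube ω hωG r hr hrr₀)
            rintro ω' ⟨-, hω'⟩
            exact (W.isCode_code ω).take_eq_of_latticePoint_eq (W.isCode_code ω') hr
              (hrr₀.le.trans hr₁) hα0 hα hω'.symm
      _ ≤ ((⌈3 / α⌉₊ + 2) ^ d : ℕ) * ENNReal.ofReal C *
          ENNReal.ofReal (r ^ ∑ k ∈ range d, s k) := by
          rw [sum_const, nsmul_eq_mul, ENNReal.ofReal_mul' (Real.rpow_nonneg hr.le _), mul_assoc]
          gcongr

end Weights

/-! ### The Bernoulli measure attached to a probability vector -/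

namespace ProbVector

variable {d : ℕ} {S : SelfAffineSponge d} (P : S.ProbVector)

/-- The weights extending `p` to the alphabet, in which a word `w` of length `d - 1` passes its mass
to the letters `w ++ [i]` in proportion to `a (w ++ [i]) ^ t(p)`. -/
noncomputable def gibbs : S.Weights where
  q w := if w.length = d then
      P.p w.dropLast * (S.a w ^ P.t / ∑ i ∈ range (S.m w.dropLast), S.a (w.dropLast ++ [i]) ^ P.t)
    else P.p w
  nonneg w hw := by
    have hd := S.two_le
    rw [if_pos (length_of_mem_treeWords hw)]
    obtain ⟨e, rfl⟩ : ∃ e, d = e + 1 := ⟨d - 1, by omega⟩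
    obtain ⟨v, hv, i, hi, rfl⟩ := mem_treeWords_succ.1 hw
    rw [List.dropLast_concat]
    exact mul_nonneg (P.nonneg e le_rfl v hv) (div_nonneg
      (Real.rpow_nonneg (S.a_pos e (by omega) v hv i hi).le _) (sum_rpow_pos hv P.t).le)
  marginal k hk w hw := by
    have hd := S.two_le
    have hlen := length_of_mem_treeWords hw
    obtain ⟨e, rfl⟩ : ∃ e, d = e + 1 := ⟨d - 1, by omega⟩
    rw [if_neg (by omega)]
    obtain h | rfl := (Nat.le_of_lt_succ hk).lt_or_eq
    · simpa [hlen, h.ne] using P.marginal k h w hw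
    · simp only [List.length_append, hlen, List.length_singleton, if_true, List.dropLast_concat]
      rw [← mul_sum, ← sum_div, div_self (sum_rpow_pos hw P.t).ne', mul_one]
  total := by
    have hd := S.two_le
    rw [if_neg (by simp; omega), P.total]

theorem gibbs_q_of_le {k : ℕ} (hk : k ≤ d - 1) {w : List ℕ} (hw : w ∈ S.words k) :
    P.gibbs.q w = P.p w := by
  have hd := S.two_le
  have hlen := length_of_mem_treeWords hw
  exact if_neg (by omega)

theorem gibbs_q_concat {w : List ℕ} (hw : w ∈ S.words (d - 1)) (i : ℕ) :
    P.gibbs.q (w ++ [i]) =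
      P.p w * (S.a (w ++ [i]) ^ P.t / ∑ j ∈ range (S.m w), S.a (w ++ [j]) ^ P.t) := by
  have hd := S.two_le
  have hlen := length_of_mem_treeWords hw
  have : (w ++ [i]).length = d := by simp [hlen]; omega
  simp [gibbs, this]

/-- For the choice `t = t(p)` the normalising factors drop out of the entropy, so that `t(p)` is the
ratio of the conditional entropy to the Lyapunov exponent in the last coordinate. -/
theorem gibbs_entropy_eq :
    (∑ w ∈ S.words (d - 1 + 1), P.gibbs.q w * Real.log (P.gibbs.q w)) -
      (∑ w ∈ S.words (d - 1), P.gibbs.q w * Real.log (P.gibbs.q w)) =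
    P.t * ∑ w ∈ S.words (d - 1 + 1), P.gibbs.q w * Real.log (S.a w) := by
  have hd := S.two_le
  have hmoran := P.t_spec.2
  rw [← sub_eq_zero, ← neg_eq_zero, ← hmoran, moran]
  simp only [words, sum_treeWords_succ]
  rw [mul_sum, ← sum_sub_distrib, ← sum_sub_distrib, ← sum_neg_distrib]
  refine sum_congr rfl fun w hw => ?_
  have hZ := sum_rpow_pos hw P.t
  have hsum := P.gibbs.marginal (d - 1) (by omega) w hw
  have hi : ∀ i ∈ range (S.m w), P.gibbs.q (w ++ [i]) * Real.log (P.gibbs.q (w ++ [i])) =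
      P.gibbs.q (w ++ [i]) * (Real.log (P.p w) -
        Real.log (∑ j ∈ range (S.m w), S.a (w ++ [j]) ^ P.t)) +
      P.t * (P.gibbs.q (w ++ [i]) * Real.log (S.a (w ++ [i]))) := by
    intro i hi
    have ha := S.a_pos (d - 1) (by omega) w hw i (mem_range.1 hi)
    rw [P.gibbs_q_concat hw]
    obtain hp | hp := eq_or_ne (P.p w) 0
    · simp [hp]
    · rw [Real.log_mul hp (div_pos (Real.rpow_pos_of_pos ha _) hZ).ne',
        Real.log_div (Real.rpow_pos_of_pos ha _).ne' hZ.ne', Real.log_rpow ha]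
      ring
  rw [sum_congr rfl hi, sum_add_distrib, ← sum_mul, ← mul_sum, ← hsum, P.gibbs_q_of_le le_rfl hw]
  ring

theorem ofReal_sub_le_dimH {Λ : Set (EuclideanSpace ℝ (Fin d))} (hΛ : S.IsLimitSet Λ) {ε : ℝ}
    (hε : 0 < ε) :
    ENNReal.ofReal ((∑ k ∈ Icc 1 (d - 1), P.lam k) + P.t - d * ε) ≤ dimH Λ := by
  have hd := S.two_le
  have h := P.gibbs.ofReal_sum_le_dimH hΛ
    (s := fun k => (if k = d - 1 then P.t else P.lam (k + 1)) - ε) (fun k hk => ?_)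
  · convert h using 2
    have hsplit : ∀ f : ℕ → ℝ, ∑ k ∈ range d, f k = ∑ k ∈ range (d - 1), f k + f (d - 1) :=
      fun f => by rw [← sum_range_succ, Nat.sub_add_cancel (by omega)]
    rw [sum_sub_distrib, hsplit, if_pos rfl, sum_const, card_range, nsmul_eq_mul,
      ← Ico_add_one_right_eq_Icc, sum_Ico_eq_sum_range]
    congr 2
    refine sum_congr rfl fun k hk => ?_
    rw [mem_range] at hk
    rw [if_neg (by omega), add_comm]
  · have hneg := P.gibbs.sum_q_mul_log_a_neg hk
    have heq : (∑ w ∈ S.words (k + 1), P.gibbs.q w * Real.log (P.gibbs.q w)) -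
        (∑ w ∈ S.words k, P.gibbs.q w * Real.log (P.gibbs.q w)) =
        (if k = d - 1 then P.t else P.lam (k + 1)) *
          ∑ w ∈ S.words (k + 1), P.gibbs.q w * Real.log (S.a w) := by
      split_ifs with hkd
      · rw [hkd, P.gibbs_entropy_eq]
      · have hq : ∀ l ≤ d - 1, ∀ f : ℝ → List ℕ → ℝ,
            ∑ w ∈ S.words l, f (P.gibbs.q w) w = ∑ w ∈ S.words l, f (P.p w) w :=
          fun l hl f => sum_congr rfl fun w hw => by rw [P.gibbs_q_of_le hl hw]
        rw [hq (k + 1) (by omega) fun x w => x * Real.log (S.a w)] at hneg ⊢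
        rw [hq (k + 1) (by omega) fun x _ => x * Real.log x,
          hq k (by omega) fun x _ => x * Real.log x, lam, Nat.add_sub_cancel,
          div_mul_cancel₀ _ hneg.ne]
    rw [heq]
    nlinarith

end ProbVector

end SelfAffineSponge

/-! ### The lower bound for the dimension -/

theorem theorem1 {d : ℕ} (S : SelfAffineSponge d) (Λ : Set (EuclideanSpace ℝ (Fin d)))
    (hΛ : S.IsLimitSet Λ) :
    (⨆ P : S.ProbVector, ENNReal.ofReal ((∑ k ∈ Finset.Icc 1 (d - 1), P.lam k) + P.t)) ≤
      dimH Λ := by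
  refine iSup_le fun P => ?_
  have hcont : Continuous fun ε : ℝ =>
      ENNReal.ofReal ((∑ k ∈ Finset.Icc 1 (d - 1), P.lam k) + P.t - d * ε) :=
    ENNReal.continuous_ofReal.comp (by fun_prop)
  have hlim := (hcont.tendsto 0).mono_left (nhdsWithin_le_nhds (s := Set.Ioi 0))
  simp only [mul_zero, sub_zero] at hlim
  exact le_of_tendsto hlim (eventually_mem_nhdsWithin.mono fun ε hε => P.ofReal_sub_le_dimH hΛ hε)
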